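/- Let $K$ be an algebraically closed field of characteristic zero (for instance $K=\mathbb{C}$) and let $q\in K$ be nonzero. For $n\geq 1$ let $$\mathscr{K}_{q,n}=\{(A,B)\in M_{n\times n}(K)\times M_{n\times n}(K)\mid AB=qBA\}$$ be the $q$-commuting variety, regarded as a Zariski closed subset of the affine space $M_{n\times n}(K)\times M_{n\times n}(K)\cong K^{2n^2}$. Then the following are equivalent: (a) $\mathscr{K}_{q,n}$ is irreducible (in the Zariski topology) for every $n\geq 1$; (b) $\mathscr{K}_{q,n}$ is irreducible for some $n\geq 1$; (c) $q=1$. -/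

import Mathlib

/-- The Zariski topology on the affine space `σ → K`: the closed sets are the zero loci of ideals
of the polynomial ring `K[X_s : s ∈ σ]`. -/
@[reducible] def zariskiTopology (σ K : Type*) [Field K] : TopologicalSpace (σ → K) :=
  TopologicalSpace.ofClosed
    {Z | ∃ I : Ideal (MvPolynomial σ K), Z = MvPolynomial.zeroLocus K I}
    ⟨⊤, by rw [MvPolynomial.zeroLocus_top]; rfl⟩
    (by
      intro A hA
      refine ⟨sSup {I | MvPolynomial.zeroLocus K I ∈ A}, ?_⟩
      rw [sSup_eq_iSup']
      ext x
      constructor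
      · intro hx
        rw [MvPolynomial.mem_zeroLocus_iff]
        have hle : (⨆ I : {I : Ideal (MvPolynomial σ K) | MvPolynomial.zeroLocus K I ∈ A},
            (I : Ideal (MvPolynomial σ K))) ≤ MvPolynomial.vanishingIdeal K {x} := by
          refine iSup_le fun I p hp => ?_
          rw [MvPolynomial.mem_vanishingIdeal_singleton_iff]
          exact hx _ I.2 p hp
        intro p hp
        exact (MvPolynomial.mem_vanishingIdeal_singleton_iff x p).1 (hle hp)
      · intro hx Z hZ
        obtain ⟨I, rfl⟩ := hA hZ
        exact MvPolynomial.zeroLocus_anti_mono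
          (le_iSup (fun I : {I : Ideal (MvPolynomial σ K) | MvPolynomial.zeroLocus K I ∈ A} =>
            (I : Ideal (MvPolynomial σ K))) ⟨I, hZ⟩) hx)
    (by
      rintro _ ⟨I, rfl⟩ _ ⟨J, rfl⟩
      refine ⟨I * J, ?_⟩
      ext x
      constructor
      · rintro (hx | hx)
        · exact MvPolynomial.zeroLocus_anti_mono Ideal.mul_le_left hx
        · exact MvPolynomial.zeroLocus_anti_mono Ideal.mul_le_right hx
      · intro hx
        by_contra hcon
        rw [Set.mem_union, not_or, MvPolynomial.mem_zeroLocus_iff,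
          MvPolynomial.mem_zeroLocus_iff] at hcon
        push Not at hcon
        obtain ⟨⟨p, hp, hp0⟩, r, hr, hr0⟩ := hcon
        have h := hx (p * r) (Ideal.mul_mem_mul hp hr)
        rw [map_mul] at h
        exact (mul_ne_zero hp0 hr0) h)

/-- The `2n²` entries of a pair of `n × n` matrices, as a point of affine space. -/
def matrixPairCoords {K : Type*} {n : ℕ} (P : Matrix (Fin n) (Fin n) K × Matrix (Fin n) (Fin n) K) :
    (Fin n × Fin n) ⊕ (Fin n × Fin n) → K :=
  Sum.elim (fun i => P.1 i.1 i.2) (fun i => P.2 i.1 i.2)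

/-- The Zariski topology on the affine space of pairs of `n × n` matrices. -/
@[reducible] def matrixPairZariski (K : Type*) [Field K] (n : ℕ) :
    TopologicalSpace (Matrix (Fin n) (Fin n) K × Matrix (Fin n) (Fin n) K) :=
  TopologicalSpace.induced matrixPairCoords
    (zariskiTopology ((Fin n × Fin n) ⊕ (Fin n × Fin n)) K)

/-- The `q`-commuting variety: the pairs `(A, B)` of `n × n` matrices with `AB = qBA`. -/
def qCommutingVariety {K : Type*} [Field K] (q : K) (n : ℕ) :
    Set (Matrix (Fin n) (Fin n) K × Matrix (Fin n) (Fin n) K) :=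
  {P | P.1 * P.2 = q • (P.2 * P.1)}

/-- Irreducibility of the `q`-commuting variety in the Zariski topology: it is nonempty and any two
nonempty relatively open subsets of it meet. -/
def QCommutingVarietyIrreducible {K : Type*} [Field K] (q : K) (n : ℕ) : Prop :=
  @IsIrreducible _ (matrixPairZariski K n) (qCommutingVariety q n)

/-! For `q ≠ 1`, invertibility of `B` gives `A = qBAB⁻¹`, so `tr A = q tr A` and `tr A = 0`. The
closed sets `tr A = 0` and `det B = 0` therefore cover the variety. The first misses `(1, 0)`,
because `n ≠ 0` in characteristic zero, and the second misses `(0, 1)`. For `q = 1`, the key is that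
`B` commutes with some `R` having a cyclic vector. Then `A + tR` commutes with `B` and is cyclic for
almost all `t`, which forces `B` to be a polynomial in it. Hence the pairs `(Y, p(Y))` are dense in
the commuting variety. Any two of them lie on a polynomial curve of such pairs, and a nonempty open
condition on that curve excludes only finitely many parameters, so two such conditions hold together
somewhere. -/

/-! ### Cyclic matrices in the commutant -/

open Polynomial in
/-- Over an infinite field, finitely many irreducible polynomials with a root can be translated so
that their powers become pairwise coprime. -/
theorem exists_pairwise_isCoprime_comp_X_sub_C {K ι : Type*} [Field K] [IsAlgClosed K] [Finite ι]
    (p : ι → K[X]) (hp : ∀ i, Irreducible (p i)) (e : ι → ℕ) :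
    ∃ c : ι → K, Pairwise fun i j =>
      IsCoprime ((p i ^ e i).comp (X - C (c i))) ((p j ^ e j).comp (X - C (c j))) := by
  have : Infinite K := IsAlgClosed.instInfinite
  choose r hr using fun i => IsAlgClosed.exists_root (p i) (hp i).degree_pos.ne'
  have hroot : ∀ i y, (p i).eval y = 0 → y = r i := by
    intro i y hy
    by_contra hne
    have h1 : p i ∣ X - C (r i) := (irreducible_X_sub_C (r i)).dvd_symm (hp i) (dvd_iff_isRoot.2 (hr i))
    obtain ⟨s, hs⟩ := h1
    have := congrArg (eval y) hs
    rw [eval_mul, hy, zero_mul] at this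
    simp [sub_eq_zero, hne] at this
  obtain ⟨m, ⟨g⟩⟩ := Finite.exists_equiv_fin ι
  let f : ι → K := fun i => Infinite.natEmbedding K (g i)
  have hf : Function.Injective f :=
    (Infinite.natEmbedding K).injective.comp (Fin.val_injective.comp g.injective)
  -- This shift moves the only root `r i` of `p i` to `f i`, and the `f i` are distinct.
  refine ⟨fun i => f i - r i, fun i j hij => ?_⟩
  simp only [pow_comp]
  refine IsCoprime.pow ?_
  rw [Polynomial.isCoprime_iff_aeval_ne_zero_of_isAlgClosed K K]
  intro a
  by_contra! h
  simp only [coe_aeval_eq_eval, eval_comp, eval_sub, eval_X, eval_C] at h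
  have h1 := hroot i _ h.1
  have h2 := hroot j _ h.2
  refine hij (hf ?_)
  linear_combination h2 - h1

open Polynomial in
/-- Every endomorphism of a finite-dimensional vector space over an algebraically closed field
commutes with an endomorphism that has a cyclic vector. -/
theorem Module.End.exists_commute_cyclic {K V : Type*} [Field K] [IsAlgClosed K] [AddCommGroup V]
    [Module K V] [FiniteDimensional K V] (B : Module.End K V) :
    ∃ R : Module.End K V, Commute R B ∧ ∃ v, ∀ w, ∃ p : K[X], aeval R p v = w := by
  obtain ⟨ι, _, p, hp, e, ⟨φ⟩⟩ := Module.equiv_directSum_of_isTorsion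
    (Module.AEval.isTorsion_of_finiteDimensional K V B)
  classical
  let ψ := φ.trans (DirectSum.linearEquivFunOnFintype K[X] ι _)
  obtain ⟨c, hc⟩ := exists_pairwise_isCoprime_comp_X_sub_C p hp e
  -- `T` is `B + c i` on the `i`-th primary summand. The shifted moduli are pairwise coprime, so by
  -- the Chinese remainder theorem `(1, …, 1)` is cyclic for `T`.
  let T : Module.End K[X] (∀ i, K[X] ⧸ Submodule.span K[X] {p i ^ e i}) :=
    LinearMap.pi fun i => (X + C (c i)) • LinearMap.proj i
  let E : V ≃ₗ[K] (∀ i, K[X] ⧸ Submodule.span K[X] {p i ^ e i}) :=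
    (Module.AEval.of K V B).trans (ψ.restrictScalars K)
  have hE : ∀ x, E (B x) = (X : K[X]) • E x := by
    intro x
    change ψ (Module.AEval.of K V B (B x)) = (X : K[X]) • ψ (Module.AEval.of K V B x)
    rw [← map_smul, Module.AEval.X_smul_of]
    rfl
  let T' : Module.End K (∀ i, K[X] ⧸ Submodule.span K[X] {p i ^ e i}) := T.restrictScalars K
  have hT : ∀ (s : K[X]) x i, aeval T' s x i = s.comp (X + C (c i)) • x i := by
    intro s x i
    induction s using Polynomial.induction_on' with
    | add s t hs ht => simp [add_smul, hs, ht]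
    | monomial n a =>
      induction n generalizing a with
      | zero =>
        rw [monomial_zero_left, aeval_C, C_comp, Module.algebraMap_end_apply, Pi.smul_apply,
          ← algebraMap_eq, algebraMap_smul]
      | succ n ih =>
        rw [← monomial_mul_X, mul_comm, map_mul, aeval_X, Module.End.mul_apply]
        change (X + C (c i)) • (aeval T' (monomial n a) x i) = _
        rw [ih, smul_smul, mul_comp, X_comp]
  refine ⟨E.symm.conj T', ?_, E.symm (fun i => Submodule.Quotient.mk 1), fun w => ?_⟩
  · refine LinearMap.ext fun x => E.injective ?_
    simp only [Module.End.mul_apply, LinearEquiv.conj_apply_apply, LinearEquiv.symm_symm, hE,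
      LinearEquiv.apply_symm_apply]
    exact map_smul T _ _
  · choose y hy using fun i => Submodule.Quotient.mk_surjective _ (E w i)
    obtain ⟨s, hs⟩ := Ideal.exists_forall_sub_mem_ideal
      (I := fun i => Ideal.span {(p i ^ e i).comp (X - C (c i))})
      (fun i j hij => Ideal.isCoprime_span_singleton_iff _ _ |>.2 (hc hij))
      (fun i => (y i).comp (X - C (c i)))
    refine ⟨s, E.injective ?_⟩
    have h1 : aeval (E.symm.conj T') s = E.symm.conj (aeval T' s) :=
      aeval_algHom_apply (LinearEquiv.conjAlgEquiv K E.symm) T' s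
    rw [h1, LinearEquiv.conj_apply_apply, LinearEquiv.symm_symm, LinearEquiv.apply_symm_apply,
      LinearEquiv.apply_symm_apply]
    funext i
    rw [hT, ← hy i, ← Submodule.Quotient.mk_smul, Submodule.Quotient.eq, smul_eq_mul, mul_one]
    obtain ⟨u, hu⟩ := Ideal.mem_span_singleton.1 (hs i)
    refine Ideal.mem_span_singleton.2 ⟨u.comp (X + C (c i)), ?_⟩
    have := congrArg (fun g => g.comp (X + C (c i))) hu
    simpa [comp_assoc] using this

/-! ### Zariski open sets and polynomial curves -/

open Topology in
/-- A basic open neighbourhood of a point in the Zariski topology on pairs of matrices. -/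
theorem exists_ne_zero_of_mem_isOpen_matrixPairZariski {K : Type*} [Field K] {n : ℕ}
    {u : Set (Matrix (Fin n) (Fin n) K × Matrix (Fin n) (Fin n) K)}
    (hu : IsOpen[matrixPairZariski K n] u) {P : Matrix (Fin n) (Fin n) K × Matrix (Fin n) (Fin n) K}
    (hP : P ∈ u) :
    ∃ f : MvPolynomial ((Fin n × Fin n) ⊕ (Fin n × Fin n)) K,
      MvPolynomial.aeval (matrixPairCoords P) f ≠ 0 ∧
        ∀ Q, MvPolynomial.aeval (matrixPairCoords Q) f ≠ 0 → Q ∈ u := by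
  obtain ⟨t, ⟨I, hI⟩, rfl⟩ := hu
  have hmem : ∀ Q : Matrix (Fin n) (Fin n) K × Matrix (Fin n) (Fin n) K,
      Q ∈ matrixPairCoords ⁻¹' t ↔ ¬ ∀ f ∈ I, MvPolynomial.aeval (matrixPairCoords Q) f = 0 := by
    intro Q
    rw [← MvPolynomial.mem_zeroLocus_iff, ← hI]
    simp
  rw [hmem] at hP
  push Not at hP
  obtain ⟨f, hf, hfP⟩ := hP
  exact ⟨f, hfP, fun Q hQ => (hmem Q).2 fun h => hQ (h f hf)⟩

open Topology in
/-- The nonvanishing locus of a polynomial is open. -/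
theorem isOpen_matrixPairZariski_aeval_ne_zero {K : Type*} [Field K] {n : ℕ}
    (f : MvPolynomial ((Fin n × Fin n) ⊕ (Fin n × Fin n)) K) :
    IsOpen[matrixPairZariski K n] {P | MvPolynomial.aeval (matrixPairCoords P) f ≠ 0} := by
  refine ⟨{x | MvPolynomial.aeval x f ≠ 0}, ⟨Ideal.span {f}, ?_⟩, rfl⟩
  rw [MvPolynomial.zeroLocus_span]
  ext x
  simp only [Set.mem_compl_iff, Set.mem_ofPred_eq, not_not, Set.mem_singleton_iff, forall_eq]

open Polynomial in
/-- A polynomial that is nonzero at one point of a polynomial curve of pairs of matrices is nonzero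
at all but finitely many points of it. -/
theorem finite_aeval_matrixPairCoords_eq_zero {K : Type*} [Field K] {n : ℕ}
    (f : MvPolynomial ((Fin n × Fin n) ⊕ (Fin n × Fin n)) K) (M N : Matrix (Fin n) (Fin n) K[X])
    {t₀ : K} (h : MvPolynomial.aeval
      (matrixPairCoords ((aeval t₀).mapMatrix M, (aeval t₀).mapMatrix N)) f ≠ 0) :
    {t : K | MvPolynomial.aeval
      (matrixPairCoords ((aeval t).mapMatrix M, (aeval t).mapMatrix N)) f = 0}.Finite := by
  have key : ∀ t : K, MvPolynomial.aeval
      (matrixPairCoords ((aeval t).mapMatrix M, (aeval t).mapMatrix N)) f =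
      (MvPolynomial.aeval (matrixPairCoords (M, N)) f : K[X]).eval t := by
    intro t
    rw [← coe_aeval_eq_eval, MvPolynomial.comp_aeval_apply]
    congr 2
    funext i
    cases i <;> rfl
  simp only [key] at h ⊢
  exact finite_setOfPred_isRoot fun h0 => h (by rw [h0, eval_zero])

/-! ### Consequences of a cyclic vector -/

open Polynomial in
/-- An operator commuting with an operator that has a cyclic vector is a polynomial in it. -/
theorem Module.End.exists_eq_aeval_of_commute_of_cyclic {K V : Type*} [Field K] [AddCommGroup V]
    [Module K V] {Y B : Module.End K V} (hYB : Commute Y B) {v : V}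
    (hv : ∀ w, ∃ p : K[X], aeval Y p v = w) : ∃ p : K[X], B = aeval Y p := by
  obtain ⟨p, hp⟩ := hv (B v)
  refine ⟨p, LinearMap.ext fun w => ?_⟩
  obtain ⟨r, rfl⟩ := hv w
  have hc : Commute (aeval Y r) B :=
    (Algebra.commute_of_mem_adjoin_singleton_of_commute (aeval_mem_adjoin_singleton K Y)
      hYB.symm).symm
  rw [← Module.End.mul_apply, ← hc.eq, Module.End.mul_apply, ← hp, ← Module.End.mul_apply,
    ← Module.End.mul_apply, ← map_mul, ← map_mul, mul_comm]

open Polynomial Matrix in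
/-- A cyclic vector of `R` is a cyclic vector of `R + s A` for all but finitely many `s`. -/
theorem Matrix.finite_not_cyclic_add_smul {K : Type*} [Field K] {n : ℕ}
    (R A : Matrix (Fin n) (Fin n) K) {v : Fin n → K}
    (hv : ∀ w, ∃ p : K[X], aeval R p *ᵥ v = w) :
    {s : K | ¬ ∀ w, ∃ p : K[X], aeval (R + s • A) p *ᵥ v = w}.Finite := by
  -- The matrix with columns `p j (R + sA) v` is the identity at `s = 0`, so its determinant is a
  -- nonzero polynomial in `s`. Away from the roots its columns span.
  choose p hp using fun j : Fin n => hv (Pi.single j 1)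
  let Z : Matrix (Fin n) (Fin n) K[X] := R.map C + (X : K[X]) • A.map C
  have hZ : ∀ s : K, (aeval s).mapMatrix Z = R + s • A := by
    intro s
    ext i j
    simp [Z, mul_comm s]
  let N : Matrix (Fin n) (Fin n) K[X] := .of fun i j => (aeval Z (p j) *ᵥ (C ∘ v)) i
  have hN : ∀ s : K, (aeval s).mapMatrix N = .of fun i j => (aeval (R + s • A) (p j) *ᵥ v) i := by
    intro s
    simp only [← hZ s, aeval_algHom_apply]
    ext i j
    simp [N, Matrix.mulVec, dotProduct, eval_finsetSum]
  have hdet : ∀ s : K, N.det.eval s = ((aeval s).mapMatrix N).det := by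
    intro s
    rw [← AlgHom.map_det, coe_aeval_eq_eval]
  have h0 : N.det ≠ 0 := by
    intro h
    have h1 := hdet 0
    rw [h, eval_zero, hN] at h1
    have : (Matrix.of fun i j => (aeval (R + (0 : K) • A) (p j) *ᵥ v) i) = 1 := by
      ext i j
      rw [Matrix.of_apply, zero_smul, add_zero, hp, Matrix.one_apply, Pi.single_apply]
    rw [this, Matrix.det_one] at h1
    exact zero_ne_one h1
  refine (finite_setOfPred_isRoot h0).subset fun s hs => ?_
  by_contra hroot
  refine hs fun w => ?_
  have hu : IsUnit ((aeval s).mapMatrix N).det := by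
    rw [← hdet]
    exact isUnit_iff_ne_zero.2 hroot
  obtain ⟨c, hc⟩ := (Matrix.mulVec_surjective_iff_isUnit.2
    ((Matrix.isUnit_iff_isUnit_det _).2 hu)) w
  refine ⟨∑ j, C (c j) * p j, ?_⟩
  rw [← hc, hN, map_sum, Matrix.sum_mulVec]
  ext i
  simp [Matrix.mulVec_eq_sum, Finset.sum_apply, Algebra.algebraMap_eq_smul_one, Finset.mul_sum,
    mul_left_comm]

open Polynomial Matrix in
/-- A matrix commuting with a matrix that has a cyclic vector is a polynomial in it. -/
theorem Matrix.exists_eq_aeval_of_commute_of_cyclic {K : Type*} [Field K] {n : ℕ}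
    {Y B : Matrix (Fin n) (Fin n) K} (hYB : Commute Y B) {v : Fin n → K}
    (hv : ∀ w, ∃ p : K[X], aeval Y p *ᵥ v = w) : ∃ p : K[X], B = aeval Y p := by
  let φ := Matrix.toLinAlgEquiv' (R := K) (n := Fin n)
  obtain ⟨p, hp⟩ := Module.End.exists_eq_aeval_of_commute_of_cyclic (Y := φ Y) (B := φ B)
    (hYB.map φ) (v := v) fun w => by
      obtain ⟨p, hp⟩ := hv w
      exact ⟨p, by rw [aeval_algHom_apply φ]; exact hp⟩
  exact ⟨p, φ.injective (by rw [hp]; exact aeval_algHom_apply φ Y p)⟩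

open Polynomial Matrix in
/-- Every square matrix over an algebraically closed field commutes with a matrix that has a cyclic
vector. -/
theorem Matrix.exists_commute_cyclic {K : Type*} [Field K] [IsAlgClosed K] {n : ℕ}
    (B : Matrix (Fin n) (Fin n) K) : ∃ R : Matrix (Fin n) (Fin n) K, Commute R B ∧
      ∃ v, ∀ w, ∃ p : K[X], aeval R p *ᵥ v = w := by
  let φ := Matrix.toLinAlgEquiv' (R := K) (n := Fin n)
  obtain ⟨R, hR, v, hv⟩ := Module.End.exists_commute_cyclic (φ B)
  refine ⟨φ.symm R, by simpa using hR.map φ.symm, v, fun w => ?_⟩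
  obtain ⟨p, hp⟩ := hv w
  refine ⟨p, ?_⟩
  rw [aeval_algHom_apply φ.symm, ← hp]
  exact congrArg (fun g : Module.End K (Fin n → K) => g v) (φ.apply_symm_apply (aeval R p))

/-! ### The case `q = 1` -/

open Polynomial in
/-- The pairs `(X, p(X))` are Zariski dense in the commuting variety. -/
theorem exists_aeval_ne_zero_of_commute {K : Type*} [Field K] [IsAlgClosed K] {n : ℕ}
    (f : MvPolynomial ((Fin n × Fin n) ⊕ (Fin n × Fin n)) K) {A B : Matrix (Fin n) (Fin n) K}
    (hAB : Commute A B) (hf : MvPolynomial.aeval (matrixPairCoords (A, B)) f ≠ 0) :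
    ∃ (Y : Matrix (Fin n) (Fin n) K) (p : K[X]),
      MvPolynomial.aeval (matrixPairCoords (Y, aeval Y p)) f ≠ 0 := by
  have : Infinite K := IsAlgClosed.instInfinite
  obtain ⟨R, hR, v, hv⟩ := B.exists_commute_cyclic
  have hline : ∀ t : K, ((aeval t).mapMatrix (A.map C + (X : K[X]) • R.map C),
      (aeval t).mapMatrix (B.map C)) = (A + t • R, B) := by
    intro t
    ext i j <;> simp [mul_comm t]
  have h1 := finite_aeval_matrixPairCoords_eq_zero f (A.map C + (X : K[X]) • R.map C) (B.map C)
    (t₀ := 0) (by rw [hline]; simpa using hf)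
  simp only [hline] at h1
  -- Cyclicity is controlled on `R + sA`, nonvanishing of `f` on `A + tR`. Taking `t = s⁻¹` makes
  -- these matrices proportional.
  obtain ⟨s, hs⟩ := ((Matrix.finite_not_cyclic_add_smul R A hv).union
    ((h1.preimage inv_injective.injOn).union (Set.finite_singleton 0))).exists_notMem
  simp only [Set.mem_union, Set.mem_preimage, Set.mem_ofPred_eq, Set.mem_singleton_iff, not_or,
    not_not] at hs
  obtain ⟨hc, hne, hs0⟩ := hs
  obtain ⟨p, hp⟩ := Matrix.exists_eq_aeval_of_commute_of_cyclic
    (hR.add_left (hAB.smul_left s)) hc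
  -- Since `R + sA = s(A + s⁻¹R)`, the variable of `p` is rescaled by `s`.
  refine ⟨A + s⁻¹ • R, p.comp (C s * X), ?_⟩
  have : aeval (A + s⁻¹ • R) (p.comp (C s * X)) = B := by
    rw [aeval_comp, hp]
    congr 1
    rw [map_mul, aeval_C, aeval_X, ← Algebra.smul_def, smul_add, smul_inv_smul₀ hs0, add_comm]
  rwa [this]

open Polynomial in
/-- The commuting variety of `n × n` matrices is irreducible (Motzkin–Taussky). -/
theorem qCommutingVarietyIrreducible_one {K : Type*} [Field K] [IsAlgClosed K] (n : ℕ) :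
    QCommutingVarietyIrreducible (1 : K) n := by
  have : Infinite K := IsAlgClosed.instInfinite
  refine ⟨⟨(0, 0), by simp [qCommutingVariety]⟩, ?_⟩
  rintro u u' hu hu' ⟨⟨A, B⟩, hAB, hABu⟩ ⟨⟨A', B'⟩, hAB', hABu'⟩
  obtain ⟨f, hf, hfu⟩ := exists_ne_zero_of_mem_isOpen_matrixPairZariski hu hABu
  obtain ⟨g, hg, hgu⟩ := exists_ne_zero_of_mem_isOpen_matrixPairZariski hu' hABu'
  obtain ⟨Y, p, hY⟩ := exists_aeval_ne_zero_of_commute f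
    (hAB.trans (one_smul K _)) hf
  obtain ⟨Y', p', hY'⟩ := exists_aeval_ne_zero_of_commute g
    (hAB'.trans (one_smul K _)) hg
  -- Interpolating matrix and polynomial together gives a curve inside the variety from `(Y, p(Y))`
  -- at `0` to `(Y', p'(Y'))` at `1`.
  let Z : Matrix (Fin n) (Fin n) K[X] := Y.map C + (X : K[X]) • (Y' - Y).map C
  let W : Matrix (Fin n) (Fin n) K[X] := aeval Z p + (X : K[X]) • aeval Z (p' - p)
  have hZ : ∀ s : K, (aeval s).mapMatrix Z = Y + s • (Y' - Y) := by
    intro s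
    ext i j
    simp [Z]
  have hW : ∀ s : K, (aeval s).mapMatrix W =
      aeval ((aeval s).mapMatrix Z) (p + C s * (p' - p)) := by
    intro s
    have hX : ∀ M : Matrix (Fin n) (Fin n) K[X],
        (aeval s).mapMatrix ((X : K[X]) • M) = s • (aeval s).mapMatrix M := by
      intro M
      ext i j
      simp
    rw [map_add (aeval s).mapMatrix, hX, ← aeval_algHom_apply, ← aeval_algHom_apply,
      map_add (aeval ((aeval s).mapMatrix Z)), map_mul, aeval_C,
      ← Algebra.smul_def]
  have h1 := finite_aeval_matrixPairCoords_eq_zero f Z W (t₀ := 0)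
    (by rw [hW, hZ]; simpa using hY)
  have h2 := finite_aeval_matrixPairCoords_eq_zero g Z W (t₀ := 1)
    (by rw [hW, hZ]; simpa using hY')
  obtain ⟨s, hs⟩ := (h1.union h2).exists_notMem
  simp only [Set.mem_union, Set.mem_ofPred_eq, not_or] at hs
  refine ⟨_, ?_, hfu _ hs.1, hgu _ hs.2⟩
  have hc : Commute ((aeval s).mapMatrix Z) ((aeval s).mapMatrix W) := by
    rw [hW]
    exact Algebra.commute_of_mem_adjoin_self (aeval_mem_adjoin_singleton K _)
  simpa [qCommutingVariety] using hc.eq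

/-! ### The case `q ≠ 1` -/

/-- If `AB = qBA` with `q ≠ 1` and `B` invertible, then `A` has trace zero. -/
theorem Matrix.trace_eq_zero_of_mul_eq_smul_mul {K : Type*} [Field K] {q : K} (hq : q ≠ 1) {n : ℕ}
    {A B : Matrix (Fin n) (Fin n) K} (h : A * B = q • (B * A)) (hB : B.det ≠ 0) :
    A.trace = 0 := by
  have hu : IsUnit B.det := isUnit_iff_ne_zero.2 hB
  have h1 : A = q • (B * A * B⁻¹) := by
    rw [← Matrix.smul_mul, ← h, Matrix.mul_nonsing_inv_cancel_right _ _ hu]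
  have h2 : A.trace = q * A.trace := by
    conv_lhs => rw [h1]
    rw [Matrix.trace_smul, Matrix.trace_mul_comm, Matrix.nonsing_inv_mul_cancel_left _ _ hu,
      smul_eq_mul]
  have h3 : (1 - q) * A.trace = 0 := by linear_combination h2
  exact (mul_eq_zero.1 h3).resolve_left (sub_ne_zero.2 hq.symm)

/-- For `q ≠ 1` the `q`-commuting variety is the union of its proper closed subsets `tr A = 0` and
`det B = 0`. -/
theorem not_qCommutingVarietyIrreducible {K : Type*} [Field K] [CharZero K] {q : K} (hq : q ≠ 1)
    {n : ℕ} (hn : 1 ≤ n) : ¬ QCommutingVarietyIrreducible q n := by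
  rintro ⟨-, h⟩
  have : NeZero n := ⟨by omega⟩
  let tr : MvPolynomial ((Fin n × Fin n) ⊕ (Fin n × Fin n)) K :=
    ∑ i, MvPolynomial.X (Sum.inl (i, i))
  let dt : MvPolynomial ((Fin n × Fin n) ⊕ (Fin n × Fin n)) K :=
    (Matrix.of fun i j => MvPolynomial.X (Sum.inr (i, j))).det
  have htr : ∀ P : Matrix (Fin n) (Fin n) K × Matrix (Fin n) (Fin n) K,
      MvPolynomial.aeval (matrixPairCoords P) tr = P.1.trace := by
    intro P
    simp [tr, matrixPairCoords, Matrix.trace]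
  have hdt : ∀ P : Matrix (Fin n) (Fin n) K × Matrix (Fin n) (Fin n) K,
      MvPolynomial.aeval (matrixPairCoords P) dt = P.2.det := by
    intro P
    rw [AlgHom.map_det]
    congr 1
    ext i j
    simp [matrixPairCoords]
  obtain ⟨⟨A, B⟩, hAB, h1, h2⟩ := h _ _ (isOpen_matrixPairZariski_aeval_ne_zero tr)
    (isOpen_matrixPairZariski_aeval_ne_zero dt)
    ⟨(1, 0), by simp [qCommutingVariety],
      show MvPolynomial.aeval (matrixPairCoords ((1 : Matrix (Fin n) (Fin n) K), _)) tr ≠ 0 by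
        rw [htr]; simp [NeZero.ne n]⟩
    ⟨(0, 1), by simp [qCommutingVariety],
      show MvPolynomial.aeval (matrixPairCoords (_, (1 : Matrix (Fin n) (Fin n) K))) dt ≠ 0 by
        rw [hdt]; simp⟩
  rw [Set.mem_ofPred_eq, htr] at h1
  rw [Set.mem_ofPred_eq, hdt] at h2
  exact h1 (Matrix.trace_eq_zero_of_mul_eq_smul_mul hq hAB h2)

theorem mainTheorem5 {K : Type*} [Field K] [IsAlgClosed K] [CharZero K] (q : K) (hq : q ≠ 0) :
    List.TFAE
      [∀ n : ℕ, 1 ≤ n → QCommutingVarietyIrreducible q n,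
       ∃ n : ℕ, 1 ≤ n ∧ QCommutingVarietyIrreducible q n,
       q = 1] := by
  tfae_have 1 → 2 := fun h => ⟨1, le_rfl, h 1 le_rfl⟩
  tfae_have 2 → 3 := by
    rintro ⟨n, hn, h⟩
    by_contra hq1
    exact not_qCommutingVarietyIrreducible hq1 hn h
  tfae_have 3 → 1 := by
    rintro rfl n -
    exact qCommutingVarietyIrreducible_one n
  tfae_finish
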